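/- **Yamamoto's theorem.** Let $m$ be a positive integer and let $A \in M_m(\mathbb{C})$. For $T \in M_m(\mathbb{C})$ and $1 \le j \le m$, let $s_j(T)$ denote the $j$-th largest singular value of $T$, that is, the nonnegative square root of the $j$-th largest eigenvalue of $T^*T$, and let $|\lambda_j|(T)$ denote the $j$-th largest element of the multiset of moduli of the eigenvalues of $T$; in both cases eigenvalues are counted with algebraic multiplicity. Then, for every $1 \le j \le m$, $$\lim_{n \to \infty} s_j(A^n)^{1/n} = |\lambda_j|(A)$$ (in particular, the limit exists). -/

import Mathlib

open Filter Topology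

noncomputable section

/-- The multiset of the moduli of the eigenvalues of a complex square matrix, the eigenvalues being
counted with algebraic multiplicity (as roots of the characteristic polynomial). -/
def eigenvalueModuli {m : ℕ} (A : Matrix (Fin m) (Fin m) ℂ) : Multiset ℝ :=
  A.charpoly.roots.map fun z => ‖z‖

/-- The multiset of eigenvalue-moduli of an `m × m` matrix has exactly `m` elements. -/
theorem card_eigenvalueModuli {m : ℕ} (A : Matrix (Fin m) (Fin m) ℂ) :
    (eigenvalueModuli A).card = m := by
  rw [eigenvalueModuli, Multiset.card_map, IsAlgClosed.card_roots_eq_natDegree,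
    Matrix.charpoly_natDegree_eq_dim, Fintype.card_fin]

/-- The `j`-th largest eigenvalue-modulus of `A`, for `1 ≤ j ≤ m`: the `j`-th entry, counted from
one, of the list of eigenvalue-moduli in decreasing order. The default value of `getD` is not
used for these `j`, since the list has length `m`. -/
def eigenvalueModulus {m : ℕ} (A : Matrix (Fin m) (Fin m) ℂ) (j : ℕ) : ℝ :=
  ((eigenvalueModuli A).sort (fun a b => b ≤ a)).getD (j - 1) 0

/-- The `j`-th largest singular value of `A`, for `1 ≤ j ≤ m`, with respect to the Euclidean inner
product on `ℂ^m`. Mathlib lists the singular values in decreasing order, counted from zero. -/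
def singularValue {m : ℕ} (A : Matrix (Fin m) (Fin m) ℂ) (j : ℕ) : ℝ :=
  (Matrix.toEuclideanLin A).singularValues (j - 1)

end

/-! Let `r` be the `j`-th largest eigenvalue modulus. The generalized eigenspaces with `‖μ‖ ≤ r`
span an invariant subspace of codimension at most `j - 1`. By Gelfand's formula, for each `c > r`,
the restriction of `A ^ n` to it eventually has norm at most `c ^ n`, so the min-max principle gives
`s_j(A ^ n) ≤ c ^ n`. Those with `r ≤ ‖μ‖` span an invariant subspace of dimension at least `j`. If
`0 < c < r`, then `A` is invertible there, and Gelfand's formula for the inverse gives `s_j(A ^ n) ≥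
c ^ n`. Taking `n`-th roots and letting `c` tend to `r` squeezes the limit. -/

open Module

/-! ### Min-max bounds for singular values. -/

section MinMax

variable {𝕜 E F : Type*} [RCLike 𝕜] [NormedAddCommGroup E] [InnerProductSpace 𝕜 E]
  [FiniteDimensional 𝕜 E] [NormedAddCommGroup F] [InnerProductSpace 𝕜 F] [FiniteDimensional 𝕜 F]

/-- A subspace of dimension larger than `#s` contains a nonzero vector whose coordinates with index
in `s` all vanish. -/
theorem exists_mem_ne_zero_repr_eq_zero {n : ℕ} (b : OrthonormalBasis (Fin n) 𝕜 E)
    (W : Submodule 𝕜 E) (s : Finset (Fin n)) (h : s.card < finrank 𝕜 W) :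
    ∃ x ∈ W, x ≠ 0 ∧ ∀ i ∈ s, b.repr x i = 0 := by
  let g : W →ₗ[𝕜] (s → 𝕜) := LinearMap.pi fun i => (b.toBasis.coord i).comp W.subtype
  have hg : g.ker ≠ ⊥ := LinearMap.ker_ne_bot_of_finrank_lt (by simpa using h)
  obtain ⟨x, hx, hx0⟩ := Submodule.exists_mem_ne_zero_of_ne_bot hg
  refine ⟨x, x.2, by simpa using hx0, fun i hi => ?_⟩
  have := congrFun (LinearMap.mem_ker.1 hx) ⟨i, hi⟩
  simpa [g] using this

/-- The squared norm of `T x` in terms of the coordinates of `x` in a singular basis. -/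
theorem norm_sq_apply_eq_sum_singularValues (T : E →ₗ[𝕜] F) (x : E) :
    ‖T x‖ ^ 2 = ∑ i : Fin (finrank 𝕜 E), T.singularValues i ^ 2 *
      ‖(T.isSymmetric_adjoint_comp_self.eigenvectorBasis rfl).repr x i‖ ^ 2 := by
  set b := T.isSymmetric_adjoint_comp_self.eigenvectorBasis rfl with hb
  have h1 : ((‖T x‖ ^ 2 : ℝ) : 𝕜) = inner 𝕜 x ((LinearMap.adjoint T ∘ₗ T) x) := by
    rw [LinearMap.comp_apply, LinearMap.adjoint_inner_right, inner_self_eq_norm_sq_to_K]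
    norm_cast
  have h2 : ((‖T x‖ ^ 2 : ℝ) : 𝕜) = ((∑ i : Fin (finrank 𝕜 E), T.singularValues i ^ 2 *
      ‖b.repr x i‖ ^ 2 : ℝ) : 𝕜) := by
    rw [h1, ← b.repr.inner_map_map, PiLp.inner_apply, RCLike.ofReal_sum]
    refine Finset.sum_congr rfl fun i _ => ?_
    rw [hb, LinearMap.IsSymmetric.eigenvectorBasis_apply_self_apply, ← hb,
      T.sq_singularValues_fin rfl, RCLike.inner_apply, mul_assoc, RCLike.mul_conj]
    push_cast
    rfl
  exact_mod_cast h2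

/-- If `T` contracts by the factor `c` on a subspace of codimension at most `k`, then its
`k`-th singular value (counted from zero) is at most `c`. -/
theorem singularValues_le_of_forall_mem (T : E →ₗ[𝕜] F) (W : Submodule 𝕜 E) {k : ℕ} {c : ℝ}
    (hc : 0 ≤ c) (hW : finrank 𝕜 E ≤ k + finrank 𝕜 W) (h : ∀ x ∈ W, ‖T x‖ ≤ c * ‖x‖) :
    T.singularValues k ≤ c := by
  by_cases hk : finrank 𝕜 E ≤ k
  · rwa [T.singularValues_of_finrank_le hk]
  push Not at hk
  set b := T.isSymmetric_adjoint_comp_self.eigenvectorBasis rfl with hb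
  -- There are `finrank 𝕜 E - 1 - k` indices above `k`, fewer than the dimension of `W`. The
  -- surviving coordinates carry singular values at least the `k`-th.
  obtain ⟨x, hxW, hx0, hx⟩ := exists_mem_ne_zero_repr_eq_zero b W (Finset.Ioi ⟨k, hk⟩)
    (by rw [Fin.card_Ioi]; simp only; omega)
  have h1 : T.singularValues k ^ 2 * ‖x‖ ^ 2 ≤ ‖T x‖ ^ 2 := by
    rw [norm_sq_apply_eq_sum_singularValues, ← hb, ← b.repr.norm_map x, EuclideanSpace.norm_sq_eq,
      Finset.mul_sum]
    refine Finset.sum_le_sum fun i _ => ?_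
    by_cases hi : (⟨k, hk⟩ : Fin _) < i
    · simp [hx i (Finset.mem_Ioi.2 hi)]
    · gcongr
      · exact T.singularValues_nonneg k
      · exact T.singularValues_antitone (not_lt.1 hi)
  have h2 : (T.singularValues k * ‖x‖) ≤ c * ‖x‖ :=
    le_trans (le_of_sq_le_sq (by rwa [mul_pow]) (norm_nonneg _)) (h x hxW)
  exact le_of_mul_le_mul_right h2 (norm_pos_iff.2 hx0)

/-- If `T` expands by the factor `c` on a subspace of dimension larger than `k`, then its
`k`-th singular value (counted from zero) is at least `c`. -/
theorem le_singularValues_of_forall_mem (T : E →ₗ[𝕜] F) (W : Submodule 𝕜 E) {k : ℕ} {c : ℝ}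
    (hW : k < finrank 𝕜 W) (h : ∀ x ∈ W, c * ‖x‖ ≤ ‖T x‖) :
    c ≤ T.singularValues k := by
  have hk : k < finrank 𝕜 E := hW.trans_le W.finrank_le
  set b := T.isSymmetric_adjoint_comp_self.eigenvectorBasis rfl with hb
  obtain ⟨x, hxW, hx0, hx⟩ := exists_mem_ne_zero_repr_eq_zero b W (Finset.Iio ⟨k, hk⟩)
    (by rwa [Fin.card_Iio])
  have h1 : ‖T x‖ ^ 2 ≤ T.singularValues k ^ 2 * ‖x‖ ^ 2 := by
    rw [norm_sq_apply_eq_sum_singularValues, ← hb, ← b.repr.norm_map x, EuclideanSpace.norm_sq_eq,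
      Finset.mul_sum]
    refine Finset.sum_le_sum fun i _ => ?_
    by_cases hi : i < (⟨k, hk⟩ : Fin _)
    · simp [hx i (Finset.mem_Iio.2 hi)]
    · gcongr
      · exact T.singularValues_nonneg i
      · exact T.singularValues_antitone (not_lt.1 hi)
  have h2 : c * ‖x‖ ≤ T.singularValues k * ‖x‖ :=
    (h x hxW).trans (le_of_sq_le_sq (by rwa [mul_pow])
      (mul_nonneg (T.singularValues_nonneg k) (norm_nonneg _)))
  exact le_of_mul_le_mul_right h2 (norm_pos_iff.2 hx0)

end MinMax

/-! ### Invariant subspaces spanned by generalized eigenspaces. -/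

section SpectralSubspace

variable {K V : Type*} [Field K] [AddCommGroup V] [Module K V]

/-- The sum of the maximal generalized eigenspaces of `f` for the eigenvalues that satisfy `p`. -/
def spectralSubspace (f : End K V) (p : K → Prop) : Submodule K V :=
  ⨆ (μ : K) (_ : p μ), f.maxGenEigenspace μ

theorem apply_mem_spectralSubspace (f : End K V) (p : K → Prop) :
    ∀ x ∈ spectralSubspace f p, f x ∈ spectralSubspace f p := by
  change spectralSubspace f p ≤ (spectralSubspace f p).comap f
  refine iSup₂_le fun μ hμ x hx => ?_
  exact le_iSup₂_of_le (f := fun μ (_ : p μ) => f.maxGenEigenspace μ) μ hμ le_rfl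
    (End.mapsTo_maxGenEigenspace_of_comm (Commute.refl f) μ hx)

/-- Generalized eigenspaces are independent, so an eigenvector for an excluded eigenvalue cannot lie
in the span of the others. -/
theorem of_hasEigenvalue_restrict_spectralSubspace (f : End K V) (p : K → Prop) {μ : K}
    (h : End.HasEigenvalue (f.restrict (apply_mem_spectralSubspace f p)) μ) : p μ := by
  by_contra hμ
  obtain ⟨x, hx⟩ := h.exists_hasEigenvector
  have hfx : f x = μ • (x : V) := congrArg Subtype.val hx.apply_eq_smul
  have hmem : (x : V) ∈ f.maxGenEigenspace μ :=
    End.eigenspace_le_maxGenEigenspace (End.mem_eigenspace_iff.2 hfx)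
  have hle : spectralSubspace f p ≤ ⨆ (ν : K) (_ : ν ≠ μ), f.maxGenEigenspace ν :=
    iSup₂_le fun ν hν => le_iSup₂_of_le (f := fun ν (_ : ν ≠ μ) => f.maxGenEigenspace ν) ν
      (fun e => hμ (e ▸ hν)) le_rfl
  have h0 := (Submodule.disjoint_def.1 (f.independent_maxGenEigenspace μ)) x hmem (hle x.2)
  exact hx.2 (Subtype.ext h0)

variable [FiniteDimensional K V]

theorem finrank_finset_sup_le {ι : Type*} (s : Finset ι) (W : ι → Submodule K V) :
    finrank K (s.sup W : Submodule K V) ≤ ∑ i ∈ s, finrank K (W i) := by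
  classical
  induction s using Finset.induction_on with
  | empty => simp
  | insert a s ha ih =>
    rw [Finset.sup_insert, Finset.sum_insert ha]
    exact (Submodule.finrank_add_le_finrank_add_finrank _ _).trans (by gcongr)

/-- Each maximal generalized eigenspace has dimension equal to the multiplicity of its root. -/
theorem finrank_spectralSubspace_le (f : End K V) (p : K → Prop) [DecidablePred p] :
    finrank K (spectralSubspace f p) ≤ f.charpoly.roots.countP p := by
  classical
  have hle : spectralSubspace f p ≤
      (f.charpoly.roots.filter p).toFinset.sup f.maxGenEigenspace := by
    refine iSup₂_le fun μ hμ => ?_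
    by_cases hr : μ ∈ f.charpoly.roots
    · exact Finset.le_sup (f := f.maxGenEigenspace)
        (Multiset.mem_toFinset.2 (Multiset.mem_filter.2 ⟨hr, hμ⟩))
    · have : f.maxGenEigenspace μ = ⊥ := by
        rw [← Submodule.finrank_eq_zero, LinearMap.finrank_maxGenEigenspace_eq,
          ← Polynomial.count_roots, Multiset.count_eq_zero]
        exact hr
      rw [this]
      exact bot_le
  refine (Submodule.finrank_mono hle).trans ((finrank_finset_sup_le _ _).trans ?_)
  rw [Multiset.countP_eq_card_filter, ← Multiset.toFinset_sum_count_eq]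
  refine Finset.sum_le_sum fun μ hμ => ?_
  rw [LinearMap.finrank_maxGenEigenspace_eq, ← Polynomial.count_roots,
    Multiset.count_filter_of_pos (Multiset.of_mem_filter (Multiset.mem_toFinset.1 hμ))]

/-- The subspaces for `p` and `¬ p` together span `V`, so the upper bound on the second forces the
lower bound on the first. -/
theorem countP_roots_le_finrank_spectralSubspace [IsAlgClosed K] (f : End K V) (p : K → Prop)
    [DecidablePred p] : f.charpoly.roots.countP p ≤ finrank K (spectralSubspace f p) := by
  have htop : spectralSubspace f p ⊔ spectralSubspace f (fun μ => ¬ p μ) = ⊤ := by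
    rw [eq_top_iff, ← f.iSup_maxGenEigenspace_eq_top]
    refine iSup_le fun μ => ?_
    by_cases hμ : p μ
    · exact le_sup_of_le_left
        (le_iSup₂_of_le (f := fun μ (_ : p μ) => f.maxGenEigenspace μ) μ hμ le_rfl)
    · exact le_sup_of_le_right
        (le_iSup₂_of_le (f := fun μ (_ : ¬ p μ) => f.maxGenEigenspace μ) μ hμ le_rfl)
  have h1 := Submodule.finrank_add_le_finrank_add_finrank (spectralSubspace f p)
    (spectralSubspace f (fun μ => ¬ p μ))
  rw [htop, finrank_top] at h1
  have h2 := finrank_spectralSubspace_le f (fun μ => ¬ p μ)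
  have h3 := f.charpoly.roots.card_eq_countP_add_countP p
  rw [IsAlgClosed.card_roots_eq_natDegree, LinearMap.charpoly_natDegree] at h3
  omega

end SpectralSubspace

/-! ### Growth of powers from bounds on eigenvalues. -/

section Growth

variable {E : Type*} [NormedAddCommGroup E] [NormedSpace ℂ E] [FiniteDimensional ℂ E]

/-- If all eigenvalues of `f` have modulus less than `c`, then `f ^ n` eventually grows at most
like `c ^ n`. -/
theorem eventually_norm_pow_apply_le (f : End ℂ E) {r c : ℝ} (hr : 0 ≤ r) (hrc : r < c)
    (h : ∀ μ, f.HasEigenvalue μ → ‖μ‖ ≤ r) :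
    ∀ᶠ n : ℕ in atTop, ∀ x, ‖(f ^ n) x‖ ≤ c ^ n * ‖x‖ := by
  have : CompleteSpace E := FiniteDimensional.complete ℂ E
  set B := End.toContinuousLinearMap (𝕜 := ℂ) E f with hB
  have hc : 0 < c := hr.trans_lt hrc
  have hrad : spectralRadius ℂ B < ENNReal.ofReal c := by
    refine lt_of_le_of_lt (iSup₂_le fun μ hμ => ?_)
      ((ENNReal.ofReal_lt_ofReal_iff hc).2 hrc)
    rw [hB, AlgEquiv.spectrum_eq, ← End.hasEigenvalue_iff_mem_spectrum] at hμ
    rw [← enorm_eq_nnnorm, ← ofReal_norm]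
    exact ENNReal.ofReal_le_ofReal (h μ hμ)
  filter_upwards [(spectrum.pow_norm_pow_one_div_tendsto_nhds_spectralRadius B).eventually_lt_const
    hrad, eventually_ne_atTop 0] with n hn hn0 x
  have h1 : ‖B ^ n‖ ^ (1 / n : ℝ) < c := (ENNReal.ofReal_lt_ofReal_iff hc).1 hn
  have h2 : ‖B ^ n‖ ≤ c ^ n := by
    have := pow_le_pow_left₀ (by positivity) h1.le n
    rwa [one_div, Real.rpow_inv_natCast_pow (norm_nonneg _) hn0] at this
  have h3 : (f ^ n) x = (B ^ n) x := by
    rw [hB, ← map_pow]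
    rfl
  rw [h3]
  exact ((B ^ n).le_opNorm x).trans (by gcongr)

/-- If all eigenvalues of `f` have modulus greater than `c`, then `f ^ n` eventually grows at least
like `c ^ n`. -/
theorem eventually_le_norm_pow_apply (f : End ℂ E) {r c : ℝ} (hc : 0 < c) (hcr : c < r)
    (h : ∀ μ, f.HasEigenvalue μ → r ≤ ‖μ‖) :
    ∀ᶠ n : ℕ in atTop, ∀ x, c ^ n * ‖x‖ ≤ ‖(f ^ n) x‖ := by
  have hr : 0 < r := hc.trans hcr
  have hunit : IsUnit f := by
    rw [← spectrum.zero_notMem_iff ℂ, ← End.hasEigenvalue_iff_mem_spectrum]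
    intro h0
    have := h 0 h0
    rw [norm_zero] at this
    exact this.not_gt hr
  obtain ⟨u, rfl⟩ := hunit
  have hinv : ∀ μ, End.HasEigenvalue (↑u⁻¹ : End ℂ E) μ → ‖μ‖ ≤ r⁻¹ := by
    intro μ hμ
    rw [End.hasEigenvalue_iff_mem_spectrum] at hμ
    have hμ0 : μ ≠ 0 := fun h0 => spectrum.zero_notMem ℂ (u⁻¹).isUnit (h0 ▸ hμ)
    have := (spectrum.inv_mem_iff (r := Units.mk0 μ hμ0) (a := u⁻¹)).1 hμ
    rw [inv_inv, ← End.hasEigenvalue_iff_mem_spectrum] at this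
    have := h _ this
    rw [Units.val_inv_eq_inv_val, Units.val_mk0, norm_inv] at this
    exact (le_inv_comm₀ hr (norm_pos_iff.2 hμ0)).1 this
  -- The upper bound for the inverse, with `r⁻¹ < c⁻¹`, is evaluated at `u ^ n` applied to `x`.
  filter_upwards [eventually_norm_pow_apply_le (↑u⁻¹ : End ℂ E) (inv_nonneg.2 hr.le)
    ((inv_lt_inv₀ hr hc).2 hcr) hinv] with n hn x
  have h1 := hn (((u : End ℂ E) ^ n) x)
  rw [← End.mul_apply, ← Units.val_pow_eq_pow_val, ← Units.val_pow_eq_pow_val, inv_pow,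
    Units.inv_mul, End.one_apply, inv_pow] at h1
  rwa [← le_inv_mul_iff₀ (by positivity)]

end Growth

/-! ### Counting entries of a decreasing list. -/

section Sorted

theorem lt_countP_le_of_pairwise_ge {l : List ℝ} (hl : l.Pairwise (fun a b => b ≤ a)) {k : ℕ}
    (hk : k < l.length) : k < l.countP (fun x => l[k] ≤ x) := by
  have h1 : (l.take (k + 1)).countP (fun x => l[k] ≤ x) = (l.take (k + 1)).length := by
    rw [List.countP_eq_length]
    intro a ha
    obtain ⟨i, hi, rfl⟩ := List.mem_iff_getElem.1 ha
    rw [List.length_take] at hi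
    rw [List.getElem_take, decide_eq_true_eq]
    rcases eq_or_lt_of_le (show i ≤ k by omega) with rfl | hik
    · exact le_rfl
    · exact List.pairwise_iff_getElem.1 hl i k _ hk hik
  have h2 := (List.take_sublist (k + 1) l).countP_le (p := fun x => decide (l[k] ≤ x))
  rw [h1, List.length_take] at h2
  omega

theorem length_le_add_countP_of_pairwise_ge {l : List ℝ} (hl : l.Pairwise (fun a b => b ≤ a))
    {k : ℕ} (hk : k < l.length) : l.length ≤ k + l.countP (fun x => x ≤ l[k]) := by
  have h1 : (l.drop k).countP (fun x => x ≤ l[k]) = (l.drop k).length := by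
    rw [List.countP_eq_length]
    intro a ha
    obtain ⟨i, hi, rfl⟩ := List.mem_iff_getElem.1 ha
    rw [List.length_drop] at hi
    rw [List.getElem_drop, decide_eq_true_eq]
    rcases Nat.eq_zero_or_pos i with rfl | hi0
    · exact le_rfl
    · exact List.pairwise_iff_getElem.1 hl k (k + i) hk _ (by omega)
  have h2 := (List.drop_sublist k l).countP_le (p := fun x => decide (x ≤ l[k]))
  rw [h1, List.length_drop] at h2
  omega

end Sorted

/-! ### Two-sided bounds for the singular values of powers. -/

section Matrix

variable {m : ℕ} (A : Matrix (Fin m) (Fin m) ℂ)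

theorem countP_eigenvalueModuli (q : ℝ → Prop) [DecidablePred q] :
    (eigenvalueModuli A).countP q =
      (LinearMap.charpoly (Matrix.toEuclideanLin A)).roots.countP fun z => q ‖z‖ := by
  rw [Matrix.toEuclideanLin_eq_toLin_orthonormal, Matrix.charpoly_toLin, eigenvalueModuli,
    Multiset.countP_map, Multiset.countP_eq_card_filter]

theorem lt_countP_eigenvalueModulus_le {j : ℕ} (hj : 1 ≤ j) (hjm : j ≤ m) :
    j - 1 < (eigenvalueModuli A).countP fun x => eigenvalueModulus A j ≤ x := by
  have hlen : ((eigenvalueModuli A).sort (fun a b => b ≤ a)).length = m := by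
    rw [Multiset.length_sort, card_eigenvalueModuli]
  have hk : j - 1 < ((eigenvalueModuli A).sort (fun a b => b ≤ a)).length := by omega
  have := lt_countP_le_of_pairwise_ge ((eigenvalueModuli A).pairwise_sort (fun a b => b ≤ a)) hk
  rwa [← Multiset.coe_countP, Multiset.sort_eq, ← List.getD_eq_getElem _ 0 hk] at this

theorem le_add_countP_le_eigenvalueModulus {j : ℕ} (hj : 1 ≤ j) (hjm : j ≤ m) :
    m ≤ j - 1 + (eigenvalueModuli A).countP fun x => x ≤ eigenvalueModulus A j := by
  have hlen : ((eigenvalueModuli A).sort (fun a b => b ≤ a)).length = m := by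
    rw [Multiset.length_sort, card_eigenvalueModuli]
  have hk : j - 1 < ((eigenvalueModuli A).sort (fun a b => b ≤ a)).length := by omega
  have := length_le_add_countP_of_pairwise_ge
    ((eigenvalueModuli A).pairwise_sort (fun a b => b ≤ a)) hk
  rwa [← Multiset.coe_countP, Multiset.sort_eq, ← List.getD_eq_getElem _ 0 hk, hlen] at this

theorem eigenvalueModulus_nonneg {j : ℕ} (hj : 1 ≤ j) (hjm : j ≤ m) :
    0 ≤ eigenvalueModulus A j := by
  have h := (Nat.zero_le _).trans_lt (lt_countP_eigenvalueModulus_le A hj hjm)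
  have hk : j - 1 < ((eigenvalueModuli A).sort (fun a b => b ≤ a)).length := by
    rw [Multiset.length_sort, card_eigenvalueModuli]
    omega
  have hmem := List.getElem_mem hk
  rw [← List.getD_eq_getElem _ 0 hk, Multiset.mem_sort] at hmem
  obtain ⟨z, -, hz⟩ := Multiset.mem_map.1 hmem
  rw [eigenvalueModulus, ← hz]
  exact norm_nonneg z

theorem eventually_singularValue_pow_le {j : ℕ} (hj : 1 ≤ j) (hjm : j ≤ m)
    {c : ℝ} (hc : eigenvalueModulus A j < c) :
    ∀ᶠ n : ℕ in atTop, singularValue (A ^ n) j ≤ c ^ n := by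
  have hr := eigenvalueModulus_nonneg A hj hjm
  set r := eigenvalueModulus A j with hr_def
  set f : End ℂ (EuclideanSpace ℂ (Fin m)) := Matrix.toEuclideanLin A with hf
  have hdim := (le_add_countP_le_eigenvalueModulus A hj hjm).trans (Nat.add_le_add_left
    ((countP_eigenvalueModuli A _).le.trans (countP_roots_le_finrank_spectralSubspace f _)) _)
  filter_upwards [eventually_norm_pow_apply_le _ hr hc fun μ hμ =>
    of_hasEigenvalue_restrict_spectralSubspace f (fun z => ‖z‖ ≤ r) hμ] with n hn
  rw [singularValue, Matrix.toLpLin_pow]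
  refine singularValues_le_of_forall_mem _ (spectralSubspace f fun z => ‖z‖ ≤ r)
    (pow_nonneg (hr.trans hc.le) n) (by simpa using hdim) fun x hx => ?_
  have := hn ⟨x, hx⟩
  rwa [End.pow_restrict] at this

theorem eventually_le_singularValue_pow {j : ℕ} (hj : 1 ≤ j) (hjm : j ≤ m)
    {c : ℝ} (hc0 : 0 < c) (hc : c < eigenvalueModulus A j) :
    ∀ᶠ n : ℕ in atTop, c ^ n ≤ singularValue (A ^ n) j := by
  set r := eigenvalueModulus A j with hr_def
  set f : End ℂ (EuclideanSpace ℂ (Fin m)) := Matrix.toEuclideanLin A with hf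
  have hdim := (lt_countP_eigenvalueModulus_le A hj hjm).trans_le
    ((countP_eigenvalueModuli A _).le.trans (countP_roots_le_finrank_spectralSubspace f _))
  filter_upwards [eventually_le_norm_pow_apply _ hc0 hc fun μ hμ =>
    of_hasEigenvalue_restrict_spectralSubspace f (fun z => r ≤ ‖z‖) hμ] with n hn
  rw [singularValue, Matrix.toLpLin_pow]
  refine le_singularValues_of_forall_mem _ (spectralSubspace f fun z => r ≤ ‖z‖) hdim
    fun x hx => ?_
  have := hn ⟨x, hx⟩
  rwa [End.pow_restrict] at this

end Matrix

theorem mainTheorem2 (m : ℕ) (A : Matrix (Fin m) (Fin m) ℂ) (j : ℕ) (hj : 1 ≤ j) (hjm : j ≤ m) :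
    Tendsto (fun n : ℕ => singularValue (A ^ n) j ^ ((1 : ℝ) / (n : ℝ))) atTop
      (𝓝 (eigenvalueModulus A j)) := by
  have hs : ∀ n, 0 ≤ singularValue (A ^ n) j := fun n => LinearMap.singularValues_nonneg _ _
  have hr := eigenvalueModulus_nonneg A hj hjm
  refine tendsto_order.2 ⟨fun a ha => ?_, fun a ha => ?_⟩
  -- The growth bound needs a positive `c` below the limit. Negative `a` are trivial, which also
  -- settles the case of limit zero.
  · rcases lt_or_ge a 0 with ha0 | ha0
    · exact Eventually.of_forall fun n => ha0.trans_le (Real.rpow_nonneg (hs n) _)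
    · obtain ⟨c, hac, hc⟩ := exists_between ha
      have hc0 := ha0.trans_lt hac
      filter_upwards [eventually_le_singularValue_pow A hj hjm hc0 hc, eventually_ne_atTop 0]
        with n hn hn0
      refine hac.trans_le ?_
      rw [one_div, ← Real.pow_rpow_inv_natCast hc0.le hn0]
      gcongr
  · obtain ⟨c, hc, hca⟩ := exists_between ha
    have hc0 := hr.trans hc.le
    filter_upwards [eventually_singularValue_pow_le A hj hjm hc, eventually_ne_atTop 0]
      with n hn hn0
    refine lt_of_le_of_lt ?_ hca
    rw [one_div, ← Real.pow_rpow_inv_natCast hc0 hn0]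
    exact Real.rpow_le_rpow (hs n) hn (by positivity)
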